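/- For integers $0\le i\le n$ let ${n \brack i}$ denote the unsigned Stirling number of the first kind, and for $s\in\mathbb{C}$ let $(s)_i=\prod_{j=1}^{i}(s-j+1)$ be the falling factorial. For an integer $n\ge 1$, a complex number $s$ and a real number $p\geq 1$, let \[ g_n(s,p)=\sum_{i=1}^{n}{n \brack i}\frac{(s)_i}{p^i}. \] Then for every real $p\ge 1$ and every $s\in\mathbb{C}$, the integral $\int_1^\infty e^{-up}u^s\,du$ and the series $\sum_{n=1}^\infty \frac{g_n(s,p)}{(n+1)!}$ both converge absolutely, and \[ \int_1^\infty e^{-up}u^s\,du=\frac{e^{-p}}{p}\left(1+\sum_{n=1}^\infty\frac{g_n(s,p)}{(n+1)!}\right). \] -/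

import Mathlib

/-- `g_n(s, p) = ∑_{i=1}^n [n, i] (s)_i / p^i`, where `[n, i]` is the unsigned Stirling number of
the first kind and `(s)_i = s (s - 1) ⋯ (s - i + 1)` is the falling factorial. -/
noncomputable def stirlingG (n : ℕ) (s : ℂ) (p : ℝ) : ℂ :=
  ∑ i ∈ Finset.Icc 1 n,
    (Nat.stirlingFirst n i : ℂ) * ((descPochhammer ℂ i).eval s / (p : ℂ) ^ i)

open MeasureTheory Set

/-! With `L(z) = 1 - log (1 - z) / p`, the function `L ^ s` is holomorphic on the unit disc and its
Taylor coefficients at 0 are `g_n / n!` (`iteratedDeriv_genFun_zero`). The substitution `x = 1 - exp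
(-p (u - 1))` makes `L(x) = u` and turns the integral into `e^{-p} / p` times the integral of `L ^
s` over `(0, 1)`; integrating `x ^ n` supplies the missing factor `1 / (n + 1)`.

Termwise integration needs absolute convergence, the hard part. The derivative of `L ^ s` is `O(‖1 -
z‖ ^ (-5/4))`, and Cauchy's estimate on a circle of radius `1 - 1/(n + 2)` yields `g_{n+1} = O(n! (n
+ 1) ^ (1/2))`, hence terms `O((n + 1) ^ (-3/2))`. -/

/-- Recurrence for weighted sums of Stirling numbers of the first kind. -/
lemma sum_stirlingFirst_succ (n : ℕ) (w : ℕ → ℂ) :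
    ∑ i ∈ Finset.range (n + 2), (Nat.stirlingFirst (n + 1) i : ℂ) * w i =
      n * ∑ i ∈ Finset.range (n + 1), (Nat.stirlingFirst n i : ℂ) * w i +
        ∑ i ∈ Finset.range (n + 1), (Nat.stirlingFirst n i : ℂ) * w (i + 1) := by
  have h1 : ∑ i ∈ Finset.range (n + 1), (Nat.stirlingFirst n i : ℂ) * w i =
      ∑ i ∈ Finset.range (n + 2), (Nat.stirlingFirst n i : ℂ) * w i := by
    rw [Finset.sum_range_succ _ (n + 1), Nat.stirlingFirst_eq_zero_of_lt (Nat.lt_succ_self n)]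
    simp
  have h0 : (n : ℂ) * (Nat.stirlingFirst n 0 : ℂ) = 0 := by
    cases n <;> simp [Nat.stirlingFirst_succ_zero]
  rw [h1, Finset.sum_range_succ' _ (n + 1), Finset.sum_range_succ' _ (n + 1), mul_add,
    ← mul_assoc, h0, Nat.stirlingFirst_succ_zero, Finset.mul_sum]
  simp only [Nat.cast_zero, zero_mul, add_zero]
  rw [← Finset.sum_add_distrib]
  refine Finset.sum_congr rfl fun i _ => ?_
  rw [Nat.stirlingFirst_succ_succ]
  push_cast
  ring

/-- `stirlingG` as a sum including the index `0`. -/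
lemma stirlingG_succ (n : ℕ) (s : ℂ) (p : ℝ) :
    stirlingG (n + 1) s p = ∑ i ∈ Finset.range (n + 2),
      (Nat.stirlingFirst (n + 1) i : ℂ) * ((descPochhammer ℂ i).eval s / (p : ℂ) ^ i) := by
  rw [Finset.range_eq_Ico, Finset.sum_eq_sum_Ico_succ_bot (by omega),
    Nat.stirlingFirst_succ_zero, stirlingG]
  simp only [Nat.cast_zero, zero_mul, zero_add]
  rfl

/-! ### Generating function and its derivatives -/

/-- The function `1 - log (1 - z) / p`. -/
noncomputable def logBase (p : ℝ) (z : ℂ) : ℂ := 1 - Complex.log (1 - z) / p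

/-- The function `(1 - log (1 - z) / p) ^ s`. -/
noncomputable def genFun (p : ℝ) (s z : ℂ) : ℂ := logBase p z ^ s

lemma one_sub_re_pos {z : ℂ} (hz : z ∈ Metric.ball (0 : ℂ) 1) : 0 < (1 - z).re := by
  have := (Complex.re_le_norm z).trans_lt (mem_ball_zero_iff.1 hz)
  simpa using this

lemma one_sub_mem_slitPlane {z : ℂ} (hz : z ∈ Metric.ball (0 : ℂ) 1) :
    1 - z ∈ Complex.slitPlane := Or.inl (one_sub_re_pos hz)

lemma norm_one_sub_pos {z : ℂ} (hz : z ∈ Metric.ball (0 : ℂ) 1) : 0 < ‖1 - z‖ :=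
  norm_pos_iff.2 (Complex.slitPlane_ne_zero (one_sub_mem_slitPlane hz))

lemma norm_one_sub_lt_two {z : ℂ} (hz : z ∈ Metric.ball (0 : ℂ) 1) : ‖1 - z‖ < 2 := by
  have := norm_sub_le 1 z
  have := mem_ball_zero_iff.1 hz
  simp only [norm_one] at *
  linarith

/-- From `‖1 - z‖ < 2` and `log 2 < 7/10`. This keeps the base off the branch cut and away from 0,
so its negative powers stay bounded. -/
lemma logBase_re_ge {p : ℝ} (hp : 1 ≤ p) {z : ℂ} (hz : z ∈ Metric.ball (0 : ℂ) 1) :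
    3 / 10 ≤ (logBase p z).re := by
  have h1 : Real.log ‖1 - z‖ ≤ Real.log 2 :=
    Real.log_le_log (norm_one_sub_pos hz) (norm_one_sub_lt_two hz).le
  have h2 := Real.log_two_lt_d9
  have h3 : (logBase p z).re = 1 - Real.log ‖1 - z‖ / p := by
    simp [logBase, Complex.div_ofReal_re, Complex.log_re]
  have h4 : Real.log ‖1 - z‖ / p ≤ 7 / 10 := by
    rw [div_le_iff₀ (by linarith)]
    nlinarith
  linarith

lemma logBase_mem_slitPlane {p : ℝ} (hp : 1 ≤ p) {z : ℂ} (hz : z ∈ Metric.ball (0 : ℂ) 1) :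
    logBase p z ∈ Complex.slitPlane := Or.inl (by linarith [logBase_re_ge hp hz])

lemma hasDerivAt_logBase {p : ℝ} {z : ℂ} (hz : z ∈ Metric.ball (0 : ℂ) 1) :
    HasDerivAt (logBase p) (1 / (p * (1 - z))) z := by
  have h := (((hasDerivAt_id z).const_sub 1).clog (one_sub_mem_slitPlane hz)).div_const (p : ℂ)
  refine (h.const_sub 1).congr_deriv ?_
  simp only [id, div_eq_mul_inv, mul_inv]
  ring

lemma hasDerivAt_logBase_cpow {p : ℝ} (hp : 1 ≤ p) (w : ℂ) {z : ℂ}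
    (hz : z ∈ Metric.ball (0 : ℂ) 1) :
    HasDerivAt (fun z => logBase p z ^ w)
      (w * logBase p z ^ (w - 1) * (1 / (p * (1 - z)))) z :=
  (hasDerivAt_logBase hz).cpow_const (logBase_mem_slitPlane hp hz)

/-- The sum whose quotient by `(1 - z) ^ n` is the `n`-th derivative of `genFun p s`. -/
noncomputable def genFunDerivSum (p : ℝ) (s : ℂ) (n : ℕ) (z : ℂ) : ℂ :=
  ∑ i ∈ Finset.range (n + 1), (Nat.stirlingFirst n i : ℂ) *
    ((descPochhammer ℂ i).eval s / (p : ℂ) ^ i * logBase p z ^ (s - i))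

/-- Differentiating a power raises `i` by one and brings out `(s - i) / (p (1 - z))`: this is the
shifted sum of the Stirling recurrence, solved for here. -/
lemma hasDerivAt_genFunDerivSum {p : ℝ} (hp : 1 ≤ p) (s : ℂ) (n : ℕ) {z : ℂ}
    (hz : z ∈ Metric.ball (0 : ℂ) 1) :
    HasDerivAt (genFunDerivSum p s n)
      ((genFunDerivSum p s (n + 1) z - n * genFunDerivSum p s n z) / (1 - z)) z := by
  have h : HasDerivAt (genFunDerivSum p s n) (∑ i ∈ Finset.range (n + 1),
      (Nat.stirlingFirst n i : ℂ) * ((descPochhammer ℂ i).eval s / (p : ℂ) ^ i *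
        ((s - i) * logBase p z ^ (s - i - 1) * (1 / (p * (1 - z)))))) z :=
    HasDerivAt.fun_sum fun i _ =>
      ((hasDerivAt_logBase_cpow hp (s - i) hz).const_mul _).const_mul _
  convert h using 1
  have hrec := sum_stirlingFirst_succ n
    (fun i => (descPochhammer ℂ i).eval s / (p : ℂ) ^ i * logBase p z ^ (s - i))
  have h1 : genFunDerivSum p s (n + 1) z - n * genFunDerivSum p s n z = _ :=
    sub_eq_of_eq_add' hrec
  have hp0 : (p : ℂ) ≠ 0 := Complex.ofReal_ne_zero.2 (by linarith)
  have hz0 := Complex.slitPlane_ne_zero (one_sub_mem_slitPlane hz)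
  rw [h1, Finset.sum_div]
  refine Finset.sum_congr rfl fun i _ => ?_
  rw [descPochhammer_succ_eval, show s - ((i + 1 : ℕ) : ℂ) = s - i - 1 by push_cast; ring]
  field_simp
  ring

lemma hasDerivAt_genFunDerivSum_div {p : ℝ} (hp : 1 ≤ p) (s : ℂ) (n : ℕ) {z : ℂ}
    (hz : z ∈ Metric.ball (0 : ℂ) 1) :
    HasDerivAt (fun z => genFunDerivSum p s n z / (1 - z) ^ n)
      (genFunDerivSum p s (n + 1) z / (1 - z) ^ (n + 1)) z := by
  have hz0 := Complex.slitPlane_ne_zero (one_sub_mem_slitPlane hz)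
  have h := (hasDerivAt_genFunDerivSum hp s n hz).div
    (((hasDerivAt_id z).const_sub 1).pow n) (pow_ne_zero n hz0)
  refine h.congr_deriv ?_
  simp only [id, Pi.pow_apply]
  rcases n with _ | n
  · simp
  · rw [Nat.add_sub_cancel]
    field_simp
    push_cast
    ring

/-- Closed form of the iterated derivatives of `genFun p s` in the unit disc. -/
lemma iteratedDeriv_genFun {p : ℝ} (hp : 1 ≤ p) (s : ℂ) (n : ℕ) :
    EqOn (iteratedDeriv n (genFun p s)) (fun z => genFunDerivSum p s n z / (1 - z) ^ n)
      (Metric.ball 0 1) := by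
  induction n with
  | zero =>
    intro z _
    simp [genFunDerivSum, genFun]
  | succ n ih =>
    intro z hz
    rw [iteratedDeriv_succ,
      (ih.eventuallyEq_of_mem (Metric.isOpen_ball.mem_nhds hz)).deriv_eq]
    exact (hasDerivAt_genFunDerivSum_div hp s n hz).deriv

lemma iteratedDeriv_genFun_zero {p : ℝ} (hp : 1 ≤ p) (s : ℂ) (n : ℕ) :
    iteratedDeriv (n + 1) (genFun p s) 0 = stirlingG (n + 1) s p := by
  rw [iteratedDeriv_genFun hp s (n + 1) (Metric.mem_ball_self one_pos), stirlingG_succ]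
  simp [genFunDerivSum, logBase]

lemma differentiableOn_genFun {p : ℝ} (hp : 1 ≤ p) (s : ℂ) :
    DifferentiableOn ℂ (genFun p s) (Metric.ball 0 1) := fun _ hz =>
  (hasDerivAt_logBase_cpow hp s hz).differentiableAt.differentiableWithinAt

/-! ### Growth of the Taylor coefficients -/

/-- Cauchy's estimate with a bound by the real part of a holomorphic function. -/
lemma norm_iteratedDeriv_le_of_norm_le_re {F G : ℂ → ℂ} {r : ℝ} (hr : 0 < r) (n : ℕ)
    (hF : DiffContOnCl ℂ F (Metric.ball 0 r)) (hG : DiffContOnCl ℂ G (Metric.ball 0 r))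
    (h : ∀ z ∈ Metric.sphere (0 : ℂ) r, ‖F z‖ ≤ (G z).re) :
    ‖iteratedDeriv n F 0‖ ≤ n.factorial * (G 0).re / r ^ n := by
  have hcl : closure (Metric.ball (0 : ℂ) r) = Metric.closedBall 0 r := closure_ball _ hr.ne'
  have hmap (θ : ℝ) : circleMap 0 r θ ∈ Metric.sphere (0 : ℂ) r :=
    circleMap_mem_sphere 0 hr.le θ
  have hGc : Continuous fun θ : ℝ => G (circleMap 0 r θ) := by
    refine hG.continuousOn.comp_continuous (by fun_prop) fun θ => ?_
    rw [hcl]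
    exact Metric.sphere_subset_closedBall (hmap θ)
  -- Mean value property: a majorant that is large near one boundary point costs only its value at
  -- the centre.
  have hmean : ∫ θ in (0 : ℝ)..2 * Real.pi, (G (circleMap 0 r θ)).re =
      2 * Real.pi * (G 0).re := by
    have h1 : Real.circleAverage G 0 r = G 0 :=
      DiffContOnCl.circleAverage (by rwa [abs_of_pos hr])
    rw [Real.circleAverage_def] at h1
    have h2 : ∫ θ in (0 : ℝ)..2 * Real.pi, G (circleMap 0 r θ) = (2 * Real.pi : ℝ) • G 0 := by
      rw [← h1, smul_smul, mul_inv_cancel₀ (by positivity), one_smul]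
    have h3 := Complex.reCLM.intervalIntegral_comp_comm (hGc.intervalIntegrable (μ := volume) 0 (2 * Real.pi))
    simp only [Complex.reCLM_apply] at h3
    rw [h3, h2]
    simp
  have hC := hF.circleIntegral_one_div_sub_center_pow_smul hr n
  have hle : ‖∮ z in C(0, r), (1 / (z - 0) ^ (n + 1)) • F z‖ ≤
      2 * Real.pi * (G 0).re / r ^ n := by
    rw [circleIntegral]
    refine (intervalIntegral.norm_integral_le_of_norm_le (g := fun θ =>
      (G (circleMap 0 r θ)).re / r ^ n) (by positivity) ?_ ?_).trans_eq ?_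
    · refine Filter.Eventually.of_forall fun θ _ => ?_
      have := h _ (hmap θ)
      simp only [deriv_circleMap, sub_zero, norm_smul, norm_mul, norm_div, norm_pow,
        norm_circleMap_zero, Complex.norm_I, norm_one, mul_one, abs_of_pos hr]
      calc r * (1 / r ^ (n + 1) * ‖F (circleMap 0 r θ)‖) = ‖F (circleMap 0 r θ)‖ / r ^ n := by
            field_simp
            ring
        _ ≤ _ := by gcongr
    · exact ((Complex.continuous_re.comp hGc).div_const _).intervalIntegrable _ _
    · rw [intervalIntegral.integral_div, hmean]
  rw [hC, norm_smul] at hle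
  have hfac : (0 : ℝ) < n.factorial := by positivity
  have hn : ‖(2 * Real.pi * Complex.I / n.factorial : ℂ)‖ = 2 * Real.pi / n.factorial := by
    simp [abs_of_pos Real.pi_pos]
  rw [hn] at hle
  have hpi := Real.pi_pos
  have h5 : ‖iteratedDeriv n F 0‖ =
      n.factorial / (2 * Real.pi) * (2 * Real.pi / n.factorial * ‖iteratedDeriv n F 0‖) := by
    field_simp
  rw [h5]
  refine (mul_le_mul_of_nonneg_left hle (by positivity)).trans_eq ?_
  field_simp

lemma norm_logBase_le {p : ℝ} (hp : 1 ≤ p) {η : ℝ} (hη : 0 < η) {z : ℂ}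
    (hz : z ∈ Metric.ball (0 : ℂ) 1) :
    ‖logBase p z‖ ≤ (2 ^ η * (2 + Real.pi) + 1 / η) * ‖1 - z‖ ^ (-η) := by
  have h0 := norm_one_sub_pos hz
  have h2 := norm_one_sub_lt_two hz
  -- Lets bounded terms be absorbed into the negative power.
  have hone : 1 ≤ 2 ^ η * ‖1 - z‖ ^ (-η) := by
    rw [Real.rpow_neg h0.le, ← div_eq_mul_inv, one_le_div (by positivity)]
    exact Real.rpow_le_rpow h0.le h2.le hη.le
  have hlow : -(‖1 - z‖ ^ (-η) / η) ≤ Real.log ‖1 - z‖ := by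
    have := Real.log_le_rpow_div (inv_nonneg.2 h0.le) hη
    rw [Real.log_inv, Real.inv_rpow h0.le, ← Real.rpow_neg h0.le] at this
    linarith
  have hup : Real.log ‖1 - z‖ ≤ 1 := by
    have := Real.log_le_sub_one_of_pos h0
    linarith
  have hpos : 0 ≤ ‖1 - z‖ ^ (-η) / η := by positivity
  have hlog : ‖Complex.log (1 - z)‖ ≤ 1 + ‖1 - z‖ ^ (-η) / η + Real.pi := by
    refine (Complex.norm_le_abs_re_add_abs_im _).trans (add_le_add ?_ ?_)
    · rw [Complex.log_re, abs_le]
      constructor <;> linarith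
    · rw [Complex.log_im]
      exact Complex.abs_arg_le_pi _
  have hdiv : ‖Complex.log (1 - z) / p‖ ≤ ‖Complex.log (1 - z)‖ := by
    rw [norm_div, Complex.norm_real, Real.norm_of_nonneg (by linarith)]
    exact div_le_self (norm_nonneg _) hp
  have h3 : ‖logBase p z‖ ≤ 1 + ‖Complex.log (1 - z) / p‖ := by
    simpa [logBase] using norm_sub_le 1 (Complex.log (1 - z) / p)
  have hpi : 0 < 2 + Real.pi := by positivity
  calc ‖logBase p z‖ ≤ (2 + Real.pi) * 1 + ‖1 - z‖ ^ (-η) / η := by linarith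
    _ ≤ (2 + Real.pi) * (2 ^ η * ‖1 - z‖ ^ (-η)) + ‖1 - z‖ ^ (-η) / η := by gcongr
    _ = _ := by ring

/-- Powers of `logBase` grow slower than any negative power of `‖1 - z‖`. -/
lemma exists_norm_logBase_cpow_le {p : ℝ} (hp : 1 ≤ p) (w : ℂ) {ε : ℝ} (hε : 0 < ε) :
    ∃ M : ℝ, 0 < M ∧ ∀ z ∈ Metric.ball (0 : ℂ) 1,
      ‖logBase p z ^ w‖ ≤ M * ‖1 - z‖ ^ (-ε) := by
  have harg (z : ℂ) : ‖logBase p z ^ w‖ ≤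
      ‖logBase p z‖ ^ w.re * Real.exp (Real.pi * |w.im|) := by
    refine (Complex.norm_cpow_le _ _).trans ?_
    rw [div_eq_mul_inv, ← Real.exp_neg]
    gcongr
    refine (neg_le_abs _).trans ?_
    rw [abs_mul]
    gcongr
    exact Complex.abs_arg_le_pi _
  rcases le_or_gt w.re 0 with hw | hw
  · refine ⟨(3 / 10) ^ w.re * 2 ^ ε * Real.exp (Real.pi * |w.im|), by positivity, fun z hz => ?_⟩
    have h0 := norm_one_sub_pos hz
    have hone : 1 ≤ 2 ^ ε * ‖1 - z‖ ^ (-ε) := by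
      rw [Real.rpow_neg h0.le, ← div_eq_mul_inv, one_le_div (by positivity)]
      exact Real.rpow_le_rpow h0.le (norm_one_sub_lt_two hz).le hε.le
    have hL : ‖logBase p z‖ ^ w.re ≤ (3 / 10) ^ w.re :=
      Real.rpow_le_rpow_of_nonpos (by norm_num)
        ((logBase_re_ge hp hz).trans (Complex.re_le_norm _)) hw
    calc ‖logBase p z ^ w‖ ≤ (3 / 10) ^ w.re * 1 * Real.exp (Real.pi * |w.im|) := by
          rw [mul_one]
          exact (harg z).trans (by gcongr)
      _ ≤ (3 / 10) ^ w.re * (2 ^ ε * ‖1 - z‖ ^ (-ε)) * Real.exp (Real.pi * |w.im|) := by gcongr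
      _ = _ := by ring
  -- Chosen so that raising the bound `‖1 - z‖ ^ (-η)` to the power `w.re` gives exponent `-ε`.
  · set η := ε / w.re with hη
    have hη0 : 0 < η := div_pos hε hw
    refine ⟨(2 ^ η * (2 + Real.pi) + 1 / η) ^ w.re * Real.exp (Real.pi * |w.im|),
      by positivity, fun z hz => ?_⟩
    have h0 := norm_one_sub_pos hz
    have hL : ‖logBase p z‖ ^ w.re ≤
        (2 ^ η * (2 + Real.pi) + 1 / η) ^ w.re * ‖1 - z‖ ^ (-ε) := by
      refine (Real.rpow_le_rpow (norm_nonneg _) (norm_logBase_le hp hη0 hz) hw.le).trans_eq ?_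
      rw [Real.mul_rpow (by positivity) (by positivity), ← Real.rpow_mul h0.le]
      congr 2
      rw [hη]
      field_simp
    refine (harg z).trans ((mul_le_mul_of_nonneg_right hL (by positivity)).trans_eq ?_)
    ring

/-- Since `|arg w| ≤ π/2`, the power has argument at most `3π/8 < π/2`, so its real part is
comparable to its norm. -/
lemma cos_mul_norm_rpow_le_re_cpow {w : ℂ} (hw : 0 < w.re) :
    Real.cos (3 * Real.pi / 8) * ‖w‖ ^ (-(3 / 4) : ℝ) ≤ (w ^ ((-(3 / 4) : ℝ) : ℂ)).re := by
  have hw0 : w ≠ 0 := by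
    rintro rfl
    simp at hw
  have habs : |Complex.arg w| ≤ Real.pi / 2 := Complex.abs_arg_le_pi_div_two_iff.2 hw.le
  rw [Complex.cpow_ofReal_re, mul_comm]
  gcongr
  rw [← Real.cos_abs (Complex.arg w * _), abs_mul, abs_of_neg (a := (-(3 / 4) : ℝ)) (by norm_num)]
  have := Real.pi_pos
  exact Real.cos_le_cos_of_nonneg_of_le_pi (by positivity) (by linarith) (by linarith)

lemma cos_three_pi_div_eight_pos : 0 < Real.cos (3 * Real.pi / 8) := by
  have := Real.pi_pos
  exact Real.cos_pos_of_mem_Ioo ⟨by linarith, by linarith⟩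

/-- Exponents split as `1/4 + 1 = 1/2 + 3/4`: the `3/4` is averaged through `Re (1 - z) ^ (-3/4)`,
and the `1/2` is bounded by `‖1 - z‖ ≥ 1 - r`. -/
lemma exists_norm_iteratedDeriv_succ_genFun_le {p : ℝ} (hp : 1 ≤ p) (s : ℂ) :
    ∃ M : ℝ, 0 < M ∧ ∀ (n : ℕ) (r : ℝ), 0 < r → r < 1 →
      ‖iteratedDeriv (n + 1) (genFun p s) 0‖ ≤
        n.factorial * (M * (1 - r) ^ (-(1 / 2) : ℝ)) / r ^ n := by
  obtain ⟨M, hM, hb⟩ := exists_norm_logBase_cpow_le hp (s - 1) (ε := 1 / 4) (by norm_num)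
  have hc := cos_three_pi_div_eight_pos
  set c := Real.cos (3 * Real.pi / 8) with hcdef
  -- The `+ 1` keeps the constant positive when `s = 0`.
  refine ⟨(‖s‖ + 1) * M / c, by positivity, fun n r hr hr1 => ?_⟩
  set K : ℝ := (‖s‖ + 1) * M / c * (1 - r) ^ (-(1 / 2) : ℝ) with hK
  have hr1' : 0 < 1 - r := by linarith
  have hK0 : 0 < K := by positivity
  have hsub : Metric.closedBall (0 : ℂ) r ⊆ Metric.ball 0 1 := Metric.closedBall_subset_ball hr1
  have hcl : closure (Metric.ball (0 : ℂ) r) = Metric.closedBall 0 r := closure_ball _ hr.ne'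
  have hF : DiffContOnCl ℂ (deriv (genFun p s)) (Metric.ball 0 r) :=
    (((differentiableOn_genFun hp s).deriv Metric.isOpen_ball).mono
      (hcl.symm ▸ hsub)).diffContOnCl
  have hG : DiffContOnCl ℂ (fun z : ℂ => (K : ℂ) * (1 - z) ^ ((-(3 / 4) : ℝ) : ℂ))
      (Metric.ball 0 r) := by
    refine DifferentiableOn.diffContOnCl fun z hz => ?_
    have hz' : z ∈ Metric.ball (0 : ℂ) 1 := hsub (hcl ▸ hz)
    exact (((differentiableAt_id.const_sub 1).cpow_const
      (one_sub_mem_slitPlane hz')).const_mul _).differentiableWithinAt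
  have h := norm_iteratedDeriv_le_of_norm_le_re hr n hF hG fun z hz => ?_
  · rw [iteratedDeriv_succ']
    simpa using h
  · have hz' : z ∈ Metric.ball (0 : ℂ) 1 := hsub (Metric.sphere_subset_closedBall hz)
    have h0 := norm_one_sub_pos hz'
    have hzr : ‖z‖ = r := by simpa using hz
    have hd : 1 - r ≤ ‖1 - z‖ := by
      have := norm_sub_norm_le 1 z
      simpa [hzr] using this
    rw [show deriv (genFun p s) z = _ from (hasDerivAt_logBase_cpow hp s hz').deriv,
      Complex.re_ofReal_mul]
    have hre := cos_mul_norm_rpow_le_re_cpow (one_sub_re_pos hz')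
    have hinv : ‖(1 / (p * (1 - z)) : ℂ)‖ ≤ ‖1 - z‖ ^ (-1 : ℝ) := by
      rw [norm_div, norm_mul, Complex.norm_real, Real.norm_of_nonneg (by linarith), norm_one,
        Real.rpow_neg_one, one_div]
      exact inv_anti₀ h0 (le_mul_of_one_le_left h0.le hp)
    have hsplit : ‖1 - z‖ ^ (-(1 / 4) : ℝ) * ‖1 - z‖ ^ (-1 : ℝ) =
        ‖1 - z‖ ^ (-(1 / 2) : ℝ) * ‖1 - z‖ ^ (-(3 / 4) : ℝ) := by
      rw [← Real.rpow_add h0, ← Real.rpow_add h0]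
      norm_num
    calc ‖s * logBase p z ^ (s - 1) * (1 / (p * (1 - z)))‖
        = ‖s‖ * ‖logBase p z ^ (s - 1)‖ * ‖(1 / (p * (1 - z)) : ℂ)‖ := by
          rw [norm_mul, norm_mul]
      _ ≤ (‖s‖ + 1) * (M * ‖1 - z‖ ^ (-(1 / 4) : ℝ)) * ‖1 - z‖ ^ (-1 : ℝ) := by
          gcongr
          · linarith
          · exact hb z hz'
      _ = (‖s‖ + 1) * M * (‖1 - z‖ ^ (-(1 / 2) : ℝ) * ‖1 - z‖ ^ (-(3 / 4) : ℝ)) := by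
          rw [← hsplit]
          ring
      _ ≤ (‖s‖ + 1) * M * ((1 - r) ^ (-(1 / 2) : ℝ) * ‖1 - z‖ ^ (-(3 / 4) : ℝ)) := by
          gcongr ?_ * (?_ * ?_)
          exact Real.rpow_le_rpow_of_nonpos hr1' hd (by norm_num)
      _ = K * (c * ‖1 - z‖ ^ (-(3 / 4) : ℝ)) := by
          rw [hK]
          field_simp
      _ ≤ _ := by gcongr

/-- Absolute convergence of the series of the `g_n(s, p) / (n + 1)!`. -/
lemma summable_norm_stirlingG_div {p : ℝ} (hp : 1 ≤ p) (s : ℂ) :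
    Summable fun n : ℕ => ‖stirlingG (n + 1) s p / ((n + 1 + 1).factorial : ℂ)‖ := by
  obtain ⟨M, hM, hb⟩ := exists_norm_iteratedDeriv_succ_genFun_le hp s
  have hsum : Summable fun n : ℕ =>
      2 * M * Real.exp 1 * (((n + 1 : ℕ) : ℝ) ^ (-(3 / 2) : ℝ)) :=
    ((summable_nat_add_iff 1).2 (Real.summable_nat_rpow.2 (by norm_num))).mul_left _
  refine hsum.of_nonneg_of_le (fun _ => norm_nonneg _) fun n => ?_
  have hn1 : (0 : ℝ) < n + 1 := by positivity
  have hn2 : (0 : ℝ) < n + 2 := by positivity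
  -- This radius balances the two factors: `1 - r = 1 / (n + 2)`, while `r ^ n ≥ 1 / e`.
  have h := hb n ((n + 1) / (n + 2)) (by positivity) ((div_lt_one hn2).2 (by linarith))
  rw [iteratedDeriv_genFun_zero hp] at h
  have hfac : (0 : ℝ) < n.factorial := by positivity
  have hpow : (((n : ℝ) + 1) / (n + 2)) ^ n ≥ (Real.exp 1)⁻¹ := by
    rw [ge_iff_le, inv_le_comm₀ (by positivity) (by positivity), ← inv_pow, inv_div]
    calc (((n : ℝ) + 2) / (n + 1)) ^ n ≤ Real.exp (1 / (n + 1)) ^ n := by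
          gcongr
          have := Real.add_one_le_exp (1 / ((n : ℝ) + 1))
          refine le_trans (le_of_eq ?_) this
          field_simp
          ring
      _ = Real.exp (n * (1 / (n + 1))) := (Real.exp_nat_mul _ _).symm
      _ ≤ Real.exp 1 := by
          gcongr
          rw [mul_one_div, div_le_one hn1]
          linarith
  have hr : 1 - ((n : ℝ) + 1) / (n + 2) = ((n : ℝ) + 2)⁻¹ := by
    field_simp
    ring
  have hroot : (1 - ((n : ℝ) + 1) / (n + 2)) ^ (-(1 / 2) : ℝ) ≤
      2 * ((n : ℝ) + 1) ^ (1 / 2 : ℝ) := by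
    rw [hr, Real.inv_rpow hn2.le, Real.rpow_neg hn2.le, inv_inv]
    calc ((n : ℝ) + 2) ^ (1 / 2 : ℝ) ≤ (4 * ((n : ℝ) + 1)) ^ (1 / 2 : ℝ) :=
          Real.rpow_le_rpow hn2.le (by linarith) (by norm_num)
      _ = 2 * ((n : ℝ) + 1) ^ (1 / 2 : ℝ) := by
          rw [Real.mul_rpow (by norm_num) hn1.le,
            show (4 : ℝ) = 2 ^ (2 : ℝ) by norm_num, ← Real.rpow_mul (by norm_num)]
          norm_num
  have hg : ‖stirlingG (n + 1) s p‖ ≤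
      n.factorial * (M * (2 * ((n : ℝ) + 1) ^ (1 / 2 : ℝ))) * Real.exp 1 := by
    refine h.trans ?_
    rw [div_eq_mul_inv]
    gcongr
    exact inv_le_of_inv_le₀ (Real.exp_pos 1) hpow
  have hsq : ((n : ℝ) + 1) ^ (-(3 / 2) : ℝ) = ((n : ℝ) + 1) ^ (1 / 2 : ℝ) / (n + 1) ^ 2 := by
    rw [← Real.rpow_natCast, ← Real.rpow_sub hn1]
    norm_num
  rw [norm_div, Complex.norm_natCast, Nat.factorial_succ, Nat.factorial_succ]
  push_cast
  rw [hsq]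
  calc ‖stirlingG (n + 1) s p‖ / ((n + 1 + 1) * ((n + 1) * n.factorial))
      ≤ n.factorial * (M * (2 * ((n : ℝ) + 1) ^ (1 / 2 : ℝ))) * Real.exp 1 /
        ((n + 1) * ((n + 1) * n.factorial)) := by
        gcongr
        linarith
    _ = _ := by
        field_simp

/-! ### The integral and its substitution -/

lemma integrableOn_exp_mul_cpow {p : ℝ} (hp : 0 < p) (s : ℂ) :
    IntegrableOn (fun u : ℝ => (Real.exp (-u * p) : ℂ) * (u : ℂ) ^ s) (Ioi 1) := by
  -- The exponent `‖s‖` replaces `s.re` because integrability near 0 requires an exponent above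
  -- `-1`.
  have h1 : IntegrableOn (fun x : ℝ => x ^ ‖s‖ * Real.exp (-p * x ^ (1 : ℝ))) (Ioi 1) :=
    (integrableOn_rpow_mul_exp_neg_mul_rpow (by linarith [norm_nonneg s]) one_pos hp).mono_set
      (Ioi_subset_Ioi zero_le_one)
  refine Integrable.mono' h1 ?_ ?_
  · refine ContinuousOn.aestronglyMeasurable (fun u hu => ?_) measurableSet_Ioi
    have hu0 : (0 : ℝ) < u := one_pos.trans hu
    refine ContinuousAt.continuousWithinAt (ContinuousAt.mul (by fun_prop) ?_)
    exact Complex.continuousAt_ofReal_cpow_const u s (Or.inr hu0.ne')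
  · refine (ae_restrict_mem measurableSet_Ioi).mono fun u (hu : 1 < u) => ?_
    rw [norm_mul, Complex.norm_real, Real.norm_of_nonneg (Real.exp_pos _).le,
      Complex.norm_cpow_eq_rpow_re_of_pos (one_pos.trans hu), mul_comm, Real.rpow_one,
      show -u * p = -p * u by ring]
    gcongr
    · exact hu.le
    · exact Complex.re_le_norm s

lemma image_one_sub_exp {p : ℝ} (hp : 0 < p) :
    (fun u : ℝ => 1 - Real.exp (-(p * (u - 1)))) '' Ioi 1 = Ioo 0 1 := by
  ext x
  simp only [mem_image, mem_Ioi, mem_Ioo]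
  constructor
  · rintro ⟨u, hu, rfl⟩
    have : Real.exp (-(p * (u - 1))) < 1 :=
      (Real.exp_lt_exp.2 (by nlinarith)).trans_eq Real.exp_zero
    exact ⟨by linarith, by linarith [Real.exp_pos (-(p * (u - 1)))]⟩
  · rintro ⟨h0, h1⟩
    refine ⟨1 - Real.log (1 - x) / p, ?_, ?_⟩
    · have : Real.log (1 - x) / p < 0 := div_neg_of_neg_of_pos
        (Real.log_neg (by linarith) (by linarith)) hp
      linarith
    · rw [show -(p * (1 - Real.log (1 - x) / p - 1)) = Real.log (1 - x) by field_simp; ring,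
        Real.exp_log (by linarith)]
      ring

lemma genFun_one_sub_exp {p : ℝ} (hp : 0 < p) (s : ℂ) (u : ℝ) :
    genFun p s ((1 - Real.exp (-(p * (u - 1))) : ℝ) : ℂ) = (u : ℂ) ^ s := by
  have h : (1 : ℂ) - ((1 - Real.exp (-(p * (u - 1))) : ℝ) : ℂ) =
      (Real.exp (-(p * (u - 1))) : ℝ) := by
    push_cast
    ring
  rw [genFun, logBase, h, ← Complex.ofReal_log (Real.exp_pos _).le, Real.log_exp]
  congr 1
  have hp0 : (p : ℂ) ≠ 0 := Complex.ofReal_ne_zero.2 hp.ne'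
  push_cast
  field_simp
  ring

/-- The substitution `x = 1 - exp (-p (u - 1))`. -/
lemma integral_genFun {p : ℝ} (hp : 0 < p) (s : ℂ) :
    ∫ x in Ioo (0 : ℝ) 1, genFun p s x =
      p * (Real.exp p : ℂ) * ∫ u in Ioi (1 : ℝ), (Real.exp (-u * p) : ℂ) * (u : ℂ) ^ s := by
  have hd (u : ℝ) : HasDerivAt (fun u : ℝ => 1 - Real.exp (-(p * (u - 1))))
      (p * Real.exp (-(p * (u - 1)))) u := by
    refine ((((((hasDerivAt_id u).sub_const 1).const_mul p).neg).exp).const_sub 1).congr_deriv ?_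
    simp [mul_comm]
  have hinj : InjOn (fun u : ℝ => 1 - Real.exp (-(p * (u - 1)))) (Ioi 1) := by
    intro u _ v _ h
    have h2 : -(p * (u - 1)) = -(p * (v - 1)) := Real.exp_injective (by simpa using h)
    have := mul_left_cancel₀ hp.ne' (neg_injective h2)
    linarith
  rw [← image_one_sub_exp hp, integral_image_eq_integral_abs_deriv_smul measurableSet_Ioi
    (fun u _ => (hd u).hasDerivWithinAt) hinj, ← integral_const_mul]
  refine integral_congr_ae (Filter.Eventually.of_forall fun u => ?_)
  simp only
  rw [genFun_one_sub_exp hp, abs_of_pos (by positivity), Complex.real_smul,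
    show -(p * (u - 1)) = p + -u * p by ring, Real.exp_add]
  push_cast
  ring

/-- Termwise integration of a power series on `(0, 1)`. -/
lemma hasSum_integral_powerSeries {a : ℕ → ℂ} {f : ℝ → ℂ}
    (hf : ∀ x ∈ Ioo (0 : ℝ) 1, HasSum (fun n => a n * (x : ℂ) ^ n) (f x))
    (ha : Summable fun n : ℕ => ‖a n / (n + 1)‖) :
    HasSum (fun n : ℕ => a n / (n + 1)) (∫ x in Ioo (0 : ℝ) 1, f x) := by
  have hint (n : ℕ) : ∫ x in Ioo (0 : ℝ) 1, x ^ n = 1 / ((n : ℝ) + 1) := by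
    rw [← integral_Ioc_eq_integral_Ioo, ← intervalIntegral.integral_of_le zero_le_one,
      integral_pow]
    simp
  have h1 (n : ℕ) : IntegrableOn (fun x : ℝ => a n * (x : ℂ) ^ n) (Ioo 0 1) :=
    ((by fun_prop : Continuous fun x : ℝ => a n * (x : ℂ) ^ n).integrableOn_Icc).mono_set
      Ioo_subset_Icc_self
  have h2 (n : ℕ) : ∫ x in Ioo (0 : ℝ) 1, ‖a n * (x : ℂ) ^ n‖ = ‖a n / (n + 1)‖ := by
    have h : ∀ x ∈ Ioo (0 : ℝ) 1, ‖a n * (x : ℂ) ^ n‖ = ‖a n‖ * x ^ n := fun x hx => by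
      rw [norm_mul, norm_pow, Complex.norm_real, Real.norm_of_nonneg hx.1.le]
    have hn : ‖(n + 1 : ℂ)‖ = (n : ℝ) + 1 := by
      exact_mod_cast Complex.norm_natCast (n + 1)
    rw [setIntegral_congr_fun measurableSet_Ioo h, integral_const_mul, hint, norm_div, hn,
      mul_one_div]
  have h3 (n : ℕ) : ∫ x in Ioo (0 : ℝ) 1, a n * (x : ℂ) ^ n = a n / (n + 1) := by
    rw [integral_const_mul]
    have : ∫ x in Ioo (0 : ℝ) 1, (x : ℂ) ^ n = ((∫ x in Ioo (0 : ℝ) 1, x ^ n : ℝ) : ℂ) := by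
      simpa using integral_ofReal (𝕜 := ℂ) (μ := volume.restrict (Ioo 0 1)) (f := fun x => x ^ n)
    rw [this, hint]
    push_cast
    ring
  have h := hasSum_integral_of_summable_integral_norm h1 (by simpa only [h2] using ha)
  simp only [h3] at h
  rwa [setIntegral_congr_fun measurableSet_Ioo fun x hx => (hf x hx).tsum_eq] at h

/-! ### Assembly -/

theorem mainTheorem1 (p : ℝ) (hp : 1 ≤ p) (s : ℂ) :
    Summable (fun n : ℕ => ‖stirlingG (n + 1) s p / ((n + 1 + 1).factorial : ℂ)‖) ∧
    MeasureTheory.IntegrableOn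
      (fun u : ℝ => (Real.exp (-u * p) : ℂ) * (u : ℂ) ^ s) (Set.Ioi 1) ∧
    ∫ u in Set.Ioi (1 : ℝ), (Real.exp (-u * p) : ℂ) * (u : ℂ) ^ s =
      (Real.exp (-p) : ℂ) / (p : ℂ) *
        (1 + ∑' n : ℕ, stirlingG (n + 1) s p / ((n + 1 + 1).factorial : ℂ)) := by
  have hp0 : 0 < p := by linarith
  have hsum := summable_norm_stirlingG_div hp s
  refine ⟨hsum, integrableOn_exp_mul_cpow hp0 s, ?_⟩
  set a : ℕ → ℂ := fun n => iteratedDeriv n (genFun p s) 0 / (n.factorial : ℂ) with ha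
  have ha0 : a 0 / ((0 : ℕ) + 1) = 1 := by
    simp [ha, genFun, logBase]
  have hterm (n : ℕ) : a (n + 1) / ((n + 1 : ℕ) + 1) =
      stirlingG (n + 1) s p / ((n + 1 + 1).factorial : ℂ) := by
    rw [ha]
    simp only
    rw [iteratedDeriv_genFun_zero hp, div_div, Nat.factorial_succ (n + 1)]
    push_cast
    ring
  have hsum' : Summable fun n : ℕ => ‖a n / (n + 1)‖ := by
    rw [← summable_nat_add_iff 1]
    simpa only [hterm] using hsum
  have hseries : ∀ x ∈ Ioo (0 : ℝ) 1, HasSum (fun n => a n * (x : ℂ) ^ n) (genFun p s x) := by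
    intro x hx
    have hx1 : (x : ℂ) ∈ Metric.ball (0 : ℂ) 1 := by
      rw [mem_ball_zero_iff, Complex.norm_real, Real.norm_of_nonneg hx.1.le]
      exact hx.2
    have h := Complex.hasSum_taylorSeries_on_ball (differentiableOn_genFun hp s) hx1
    refine (congrArg (HasSum · _) (funext fun n => ?_)).mpr h
    simp only [a, sub_zero, smul_eq_mul]
    ring
  have hI := hasSum_integral_powerSeries hseries hsum'
  have hval : ∫ x in Ioo (0 : ℝ) 1, genFun p s x =
      1 + ∑' n : ℕ, stirlingG (n + 1) s p / ((n + 1 + 1).factorial : ℂ) := by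
    rw [← hI.tsum_eq, hI.summable.tsum_eq_zero_add, ha0]
    simp only [hterm]
  rw [← hval, integral_genFun hp0, Real.exp_neg]
  have h1 : (p : ℂ) ≠ 0 := Complex.ofReal_ne_zero.2 hp0.ne'
  have h2 : (Real.exp p : ℂ) ≠ 0 := Complex.ofReal_ne_zero.2 (Real.exp_pos p).ne'
  rw [Complex.ofReal_inv]
  generalize ∫ u in Ioi (1 : ℝ), (Real.exp (-u * p) : ℂ) * (u : ℂ) ^ s = J
  field_simp
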